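/- \textbf{Theorem (Poisson Dirichlet limit).} Let $\mathbb Y$ be a compact Polish space with its Borel $\sigma$-field and let $\mathbf M$ be a Borel probability measure on $\mathbb Y$. Let $\mathfrak N_{\mathbb Y}$ be the set of finite measures on $\mathbb Y$ with values in $\mathbf N$ (configurations), with the vague topology (generated by the maps $\omega\mapsto\int f\,d\omega$, $f$ continuous on $\mathbb Y$) and its Borel $\sigma$-field, and let $\mathbf P$ be the law on $\mathfrak N_{\mathbb Y}$ of the Poisson point process with control measure $\mathbf M$: under $\mathbf P$, $\omega(A)$ is Poisson distributed with parameter $\mathbf M(A)$ for every measurable $A$, and $\omega(A_1),\dots,\omega(A_n)$ are independent whenever $A_1,\dots,A_n$ are measurable and pairwise disjoint. Write $\varepsilon_x$ for the unit mass at $x$ and $D_xF(\omega)=F(\omega+\varepsilon_x)-F(\omega)$. Let $\mathbf D_P$ be the set of measurable $F:\mathfrak N_{\mathbb Y}\to\mathbf R$ with $\mathbf E\bigl[\int_{\mathbb Y}|D_xF|^2\,d\mathbf M(x)\bigr]<\infty$, and for $F\in\mathbf D_P$ set $$\mathcal E(F)=\mathbf E\Bigl[\int_{\mathbb Y}|D_xF|^2\,d\mathbf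 M(x)\Bigr].$$ A function $F:\mathfrak N_{\mathbb Y}\to\mathbf R$ is called TV-Lip if it is continuous for the vague topology and $|F(\omega)-F(\eta)|\le \operatorname{dist}_{TV}(\omega,\eta)$ for all $\omega,\eta\in\mathfrak N_{\mathbb Y}$, where $\operatorname{dist}_{TV}(\omega,\eta)=|\omega-\eta|(\mathbb Y)$ is the total mass of the variation of $\omega-\eta$. For every $N$ let $\zeta_1^N,\dots,\zeta_N^N$ be points of $\mathbb Y$ and let $p_1^N,\dots,p_N^N\ge 0$ be real numbers such that $$\sup_{k\le N}p_k^N=O\Bigl(\frac1N\Bigr)\quad (N\to\infty)$$ and, for every continuous $\mathbf M$-integrable $f:\mathbb Y\to\mathbf R$, $$\sum_{k=1}^N f(\zeta_k^N)\,p_k^N\xrightarrow[N\to\infty]{}\int_{\mathbb Y} f\,d\mathbf M .$$ Let $\mu_k^N$ be the Poisson distribution on $\mathbf N$ with parameter $p_k^N$, let $\mu^N=\bigotimes_{k=1}^N\mu_k^N$ on $\mathbf N^N$, and let $U_N:\mathbf N^N\to\mathfrak N_{\mathbb Y}$, $U_N(m_1,\dots,m_N)=\sum_{k=1}^N m_k\,\varepsilon_{\zeta_k^N}$.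 For $G\in L^2(\mu^N)$ put $$D_kG(m)=G(m)-\int_{\mathbf N} G(m_1,\dots,m_{k-1},\tau,m_{k+1},\dots,m_N)\,d\mu_k^N(\tau),\qquad \mathcal E_N(G)=\int_{\mathbf N^N}\sum_{k=1}^N|D_kG|^2\,d\mu^N ,$$ and let $\mathcal E^{U_N}(F)=\mathcal E_N(F\circ U_N)$ be the image Dirichlet form. Then, for every TV-Lip function $F\in\mathbf D_P$, one has $F\circ U_N\in L^2(\mu^N)$ for every $N$, and $$\mathcal E^{U_N}(F)\xrightarrow[N\to\infty]{}\mathcal E(F).$$ -/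

import Mathlib

open MeasureTheory ProbabilityTheory Filter Topology
open scoped NNReal ENNReal

noncomputable section

namespace PoissonDirichlet

section Independent

variable {A : Type*} [Fintype A] [DecidableEq A] {E : A → Type*} [∀ a, MeasurableSpace (E a)]

/-- The discrete gradient on a finite product of probability spaces:
`D_a G (x) = G (x) - ∫ G (x with its coordinate a replaced by y) dP_a(y)`. -/
def discreteGradient (P : ∀ a, Measure (E a)) (a : A) (G : (∀ a, E a) → ℝ) (x : ∀ a, E a) : ℝ :=
  G x - ∫ y, G (Function.update x a y) ∂(P a)

/-- The domain of the Dirichlet form of independent coordinates. The index set being finite,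
every square integrable function is cylindrical, hence the domain is the whole of `L²`. -/
def InDomain (P : ∀ a, Measure (E a)) (G : (∀ a, E a) → ℝ) : Prop :=
  MemLp G 2 (Measure.pi P)

/-- The Dirichlet form of independent coordinates, `𝓔_A(G) = 𝐄 [∑ a, |D_a G|²]`. -/
def dirichletForm (P : ∀ a, Measure (E a)) (G : (∀ a, E a) → ℝ) : ℝ :=
  ∫ x, ∑ a, |discreteGradient P a G x| ^ 2 ∂(Measure.pi P)

/-- The image form `𝓔^U(F) = 𝓔_A(F ∘ U)` of a map `U` defined on the product space. -/
def imageDirichletForm {W : Type*} (P : ∀ a, Measure (E a)) (U : (∀ a, E a) → W) (F : W → ℝ) : ℝ :=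
  dirichletForm P (F ∘ U)

end Independent

section Configurations

/-- The finite measures on `Y` which take only integer values on measurable sets. On a compact
space these are the locally finite integer-valued measures. -/
def integerValued (Y : Type*) [MeasurableSpace Y] : AddSubmonoid (FiniteMeasure Y) where
  carrier := {ω | ∀ s : Set Y, MeasurableSet s → ∃ n : ℕ, ω s = n}
  zero_mem' := fun s _ => ⟨0, by simp⟩
  add_mem' := by
    intro ω η hω hη s hs
    obtain ⟨m, hm⟩ := hω s hs
    obtain ⟨n, hn⟩ := hη s hs
    exact ⟨m + n, by simp [hm, hn]⟩

/-- The space of configurations on `Y`. It carries the subspace topology of the topology of weak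
convergence on `FiniteMeasure Y` (for compact `Y` this is the vague topology, generated by the maps
`ω ↦ ∫ f dω`, `f` continuous) and the σ-field generated by the evaluations `ω ↦ ω s` (for a
compact Polish space `Y` this is its Borel σ-field). -/
abbrev Configuration (Y : Type*) [MeasurableSpace Y] : Type _ := integerValued Y

variable {Y : Type*} [MeasurableSpace Y]

/-- The unit point mass `ε_x`. -/
def pointMass (x : Y) : Configuration Y :=
  ⟨⟨Measure.dirac x, inferInstance⟩, by
    intro s hs
    by_cases hx : x ∈ s
    · exact ⟨1, by simp [Measure.dirac_apply' x hs, hx]⟩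
    · exact ⟨0, by simp [Measure.dirac_apply' x hs, hx]⟩⟩

/-- The number `ω(s)` of points of `ω` in `s`, as a natural number. -/
def Configuration.count (ω : Configuration Y) (s : Set Y) : ℕ := ⌊(ω : FiniteMeasure Y) s⌋₊

theorem Configuration.coe_count (ω : Configuration Y) {s : Set Y} (hs : MeasurableSet s) :
    (ω.count s : ℝ≥0) = (ω : FiniteMeasure Y) s := by
  obtain ⟨n, hn⟩ := ω.2 s hs
  rw [Configuration.count, hn, Nat.floor_natCast]

/-- The distance in total variation, `|ω - η|(Y)`: the number of points, counted with multiplicity,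
that belong to one of the two configurations and not to the other. -/
def distTV (ω η : Configuration Y) : ℝ :=
  (((ω : FiniteMeasure Y) : Measure Y).toSignedMeasure -
    ((η : FiniteMeasure Y) : Measure Y).toSignedMeasure).totalVariation.real Set.univ

/-- `P` is the law of a Poisson point process with control (intensity) measure `M`. -/
structure IsPoissonPointProcess (M : Measure Y) [IsFiniteMeasure M]
    (P : Measure (Configuration Y)) : Prop where
  /-- The number of points in `s` has the Poisson distribution of parameter `M s`. -/
  hasLaw_count : ∀ s : Set Y, MeasurableSet s →
    HasLaw (fun ω : Configuration Y => ω.count s) (poissonMeasure (M s).toNNReal) P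
  /-- The numbers of points in disjoint sets are independent. -/
  iIndepFun_count : ∀ (n : ℕ) (s : Fin n → Set Y), (∀ i, MeasurableSet (s i)) →
    Pairwise (fun i j => Disjoint (s i) (s j)) →
      iIndepFun (fun (i : Fin n) (ω : Configuration Y) => ω.count (s i)) P

/-- The difference gradient `D_x F (ω) = F (ω + ε_x) - F (ω)`. -/
def differenceGradient (x : Y) (F : Configuration Y → ℝ) (ω : Configuration Y) : ℝ :=
  F (ω + pointMass x) - F ω

/-- The class `𝐃_P` of the random variables `F` with `𝐄 [∫ |D_x F|² dM(x)] < ∞`. -/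
def InPoissonDomain (M : Measure Y) (P : Measure (Configuration Y)) (F : Configuration Y → ℝ) :
    Prop :=
  Measurable F ∧ ∫⁻ ω, ∫⁻ x, ENNReal.ofReal (|differenceGradient x F ω| ^ 2) ∂M ∂P < ∞

/-- The Poisson Dirichlet form `𝓔(F) = 𝐄 [∫ |D_x F|² dM(x)]`. -/
def poissonDirichletForm (M : Measure Y) (P : Measure (Configuration Y))
    (F : Configuration Y → ℝ) : ℝ :=
  ∫ ω, ∫ x, |differenceGradient x F ω| ^ 2 ∂M ∂P

/-- `F` is TV-Lip: continuous for the vague topology and `1`-Lipschitz for the distance in total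
variation. -/
structure TVLip [TopologicalSpace Y] [OpensMeasurableSpace Y] (F : Configuration Y → ℝ) :
    Prop where
  continuous : Continuous F
  abs_sub_le : ∀ ω η : Configuration Y, |F ω - F η| ≤ distTV ω η

/-- The map `(m_1, …, m_N) ↦ ∑ k, m_k ε_{ζ_k}`. -/
def toConfiguration {N : ℕ} (ζ : Fin N → Y) (m : Fin N → ℕ) : Configuration Y :=
  ∑ k, m k • pointMass (ζ k)

end Configurations

end PoissonDirichlet

end

/-! Resampling one coordinate turns the integral of `|D_k G|²` into a mean of one-dimensional
Poisson variances. For a small parameter `r`, the variance of a function with increments at most 1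
is `r` times its mean squared increment, up to `4 r²`. For `G = F ∘ U_N` the increments are the
difference gradients `D_{ζ_k} F`, bounded by 1 because `F` is TV-Lip. Hence `𝓔^{U_N}(F)` differs
from `∑ p_k 𝐄|D_{ζ_k} F(U_N)|²` by at most `4 ∑ p_k² ≤ 4 (sup p_k) ∑ p_k → 0`
(`TVLip.abs_imageDirichletForm_sub_le`, `tendsto_sum_sq_of_isBigO`).

The sum is itself a Poisson Dirichlet form: `U_N` has the law of a Poisson process of intensity `∑
p_k ε_{ζ_k} = a_N π_N`, with `π_N` a probability. Characteristic functionals identify this law, and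
`P`, with a Poisson number of i.i.d. points (`map_toConfiguration_eq_poissonMixture`,
`IsPoissonPointProcess.eq_poissonMixture`). Since `a_N → 1` and `π_N → M` weakly, each term with a
fixed number of points converges. Dominated convergence over that number concludes
(`tendsto_integral_integral_poissonMixture`), as `|D_x F(ω)|²` is bounded and jointly continuous. -/

noncomputable section

namespace PoissonDirichlet

/-! ### Configurations: topology, measurability, evaluations. -/

section ConfigurationSpace

variable {Y : Type*} [MeasurableSpace Y]

theorem toMeasure_add (ω η : Configuration Y) :
    (((ω + η : Configuration Y) : FiniteMeasure Y) : Measure Y) =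
      ((ω : FiniteMeasure Y) : Measure Y) + ((η : FiniteMeasure Y) : Measure Y) := rfl

theorem toMeasure_pointMass (x : Y) :
    ((pointMass x : FiniteMeasure Y) : Measure Y) = Measure.dirac x := rfl

/-- The signed difference is the positive measure `η`, whose total variation is its own mass. -/
theorem distTV_add_left_le (ω η : Configuration Y) :
    distTV (ω + η) ω ≤ ((η : FiniteMeasure Y) : Measure Y).real Set.univ := by
  have h : (((ω + η : Configuration Y) : FiniteMeasure Y) : Measure Y).toSignedMeasure -
      ((ω : FiniteMeasure Y) : Measure Y).toSignedMeasure =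
      ((η : FiniteMeasure Y) : Measure Y).toSignedMeasure := by
    have := Measure.toSignedMeasure_add ((ω : FiniteMeasure Y) : Measure Y)
      ((η : FiniteMeasure Y) : Measure Y)
    exact sub_eq_of_eq_add' this
  rw [distTV, h, SignedMeasure.totalVariation_eq_variation, Measure.variation_toSignedMeasure]

theorem TVLip.abs_add_pointMass_sub_le [TopologicalSpace Y] [OpensMeasurableSpace Y]
    {F : Configuration Y → ℝ} (hF : TVLip F) (ω : Configuration Y) (x : Y) :
    |F (ω + pointMass x) - F ω| ≤ 1 := by
  refine (hF.abs_sub_le _ _).trans ((distTV_add_left_le ω (pointMass x)).trans ?_)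
  rw [toMeasure_pointMass]
  simp

theorem continuous_pointMass [TopologicalSpace Y] [OpensMeasurableSpace Y] :
    Continuous (pointMass : Y → Configuration Y) := by
  refine Topology.IsInducing.subtypeVal.continuous_iff.2 (continuous_iff_continuousAt.2 fun x => ?_)
  refine FiniteMeasure.tendsto_iff_forall_lintegral_tendsto.2 fun f => ?_
  have hm : Measurable fun y => (f y : ℝ≥0∞) := f.continuous.measurable.coe_nnreal_ennreal
  change Tendsto (fun y => ∫⁻ z, (f z : ℝ≥0∞) ∂Measure.dirac y) _
    (𝓝 (∫⁻ z, (f z : ℝ≥0∞) ∂Measure.dirac x))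
  simp_rw [lintegral_dirac' _ hm]
  exact (ENNReal.continuous_coe.comp f.continuous).continuousAt

theorem measurable_configuration_of_measurable_apply {Ω : Type*} [MeasurableSpace Ω]
    {f : Ω → Configuration Y}
    (h : ∀ s, MeasurableSet s → Measurable fun a => ((f a : FiniteMeasure Y) : Measure Y) s) :
    Measurable f :=
  Measurable.subtype_mk (Measurable.subtype_mk (Measure.measurable_of_measurable_coe _ h))

theorem measurable_configuration_apply {s : Set Y} (hs : MeasurableSet s) :
    Measurable fun ω : Configuration Y => ((ω : FiniteMeasure Y) : Measure Y) s :=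
  (Measure.measurable_coe hs).comp (measurable_subtype_coe.comp measurable_subtype_coe)

theorem measurable_configuration_add :
    Measurable fun q : Configuration Y × Configuration Y => q.1 + q.2 := by
  refine measurable_configuration_of_measurable_apply fun s hs => ?_
  simp only [toMeasure_add, Measure.add_apply]
  exact ((measurable_configuration_apply hs).comp measurable_fst).add
    ((measurable_configuration_apply hs).comp measurable_snd)

theorem measurable_pointMass : Measurable (pointMass : Y → Configuration Y) :=
  Measurable.subtype_mk (Measurable.subtype_mk Measure.measurable_dirac)

instance : MeasurableAdd₂ (Configuration Y) := ⟨measurable_configuration_add⟩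

/-- The configuration `∑ j, ε_{x j}`. -/
def diracSum {n : ℕ} (x : Fin n → Y) : Configuration Y := ∑ j, pointMass (x j)

theorem measurable_diracSum {n : ℕ} : Measurable (diracSum : (Fin n → Y) → Configuration Y) :=
  Finset.measurable_fun_sum _ fun j _ => measurable_pointMass.comp (measurable_pi_apply j)

theorem continuous_diracSum [TopologicalSpace Y] [OpensMeasurableSpace Y] {n : ℕ} :
    Continuous (diracSum : (Fin n → Y) → Configuration Y) :=
  continuous_finsetSum _ fun j _ => continuous_pointMass.comp (continuous_apply j)

theorem measureReal_add (ω η : Configuration Y) (s : Set Y) :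
    (((ω + η : Configuration Y) : FiniteMeasure Y) : Measure Y).real s =
      ((ω : FiniteMeasure Y) : Measure Y).real s + ((η : FiniteMeasure Y) : Measure Y).real s := by
  rw [toMeasure_add, measureReal_add_apply]

theorem measureReal_pointMass (x : Y) {s : Set Y} (hs : MeasurableSet s) :
    ((pointMass x : FiniteMeasure Y) : Measure Y).real s = s.indicator 1 x := by
  rw [toMeasure_pointMass, measureReal_def, Measure.dirac_apply' x hs]
  by_cases h : x ∈ s <;> simp [h]

/-- The evaluation `ω ↦ ω s` as a homomorphism. -/
def evalHom (s : Set Y) : Configuration Y →+ ℝ where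
  toFun ω := ((ω : FiniteMeasure Y) : Measure Y).real s
  map_zero' := by
    change (0 : Measure Y).real s = 0
    simp
  map_add' ω η := measureReal_add ω η s

theorem evalHom_apply (s : Set Y) (ω : Configuration Y) :
    evalHom s ω = ((ω : FiniteMeasure Y) : Measure Y).real s := rfl

theorem evalHom_pointMass {s : Set Y} (hs : MeasurableSet s) (x : Y) :
    evalHom s (pointMass x) = s.indicator 1 x := measureReal_pointMass x hs

theorem measurable_evalHom {s : Set Y} (hs : MeasurableSet s) :
    Measurable (evalHom s : Configuration Y → ℝ) :=
  (measurable_configuration_apply hs).ennreal_toReal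

theorem evalHom_diracSum {s : Set Y} (hs : MeasurableSet s) {n : ℕ} (x : Fin n → Y) :
    evalHom s (diracSum x) = ∑ j, s.indicator (1 : Y → ℝ) (x j) := by
  simp [diracSum, map_sum, evalHom_pointMass hs]

theorem evalHom_toConfiguration {s : Set Y} (hs : MeasurableSet s) {N : ℕ} (ζ : Fin N → Y)
    (m : Fin N → ℕ) :
    evalHom s (toConfiguration ζ m) = ∑ k, (m k : ℝ) * s.indicator (1 : Y → ℝ) (ζ k) := by
  simp only [toConfiguration, map_sum, map_nsmul, evalHom_pointMass hs, nsmul_eq_mul]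

theorem evalHom_eq_count {s : Set Y} (hs : MeasurableSet s) (ω : Configuration Y) :
    evalHom s ω = ω.count s := by
  have := Configuration.coe_count ω hs
  rw [evalHom_apply, measureReal_def, ← FiniteMeasure.ennreal_coeFn_eq_coeFn_toMeasure, ← this]
  simp

theorem measurable_differenceGradient {F : Configuration Y → ℝ} (hF : Measurable F) :
    Measurable fun q : Configuration Y × Y => differenceGradient q.2 F q.1 :=
  (hF.comp (measurable_fst.add (measurable_pointMass.comp measurable_snd))).sub
    (hF.comp measurable_fst)

theorem continuous_differenceGradient [TopologicalSpace Y] [OpensMeasurableSpace Y]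
    {F : Configuration Y → ℝ} (hF : Continuous F) :
    Continuous fun q : Configuration Y × Y => differenceGradient q.2 F q.1 :=
  (hF.comp (continuous_fst.add (continuous_pointMass.comp continuous_snd))).sub
    (hF.comp continuous_fst)

/-- This identifies unit increments of `F ∘ U_N` in coordinate `k` with difference gradients at
`ζ_k`. -/
theorem toConfiguration_update_succ {N : ℕ} (ζ : Fin N → Y) (m : Fin N → ℕ) (k : Fin N) (j : ℕ) :
    toConfiguration ζ (Function.update m k (j + 1)) =
      toConfiguration ζ (Function.update m k j) + pointMass (ζ k) := by
  have h (i : ℕ) : toConfiguration ζ (Function.update m k i) =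
      i • pointMass (ζ k) + ∑ l ∈ Finset.univ.erase k, m l • pointMass (ζ l) := by
    rw [toConfiguration, ← Finset.add_sum_erase _ _ (Finset.mem_univ k), Function.update_self]
    congr 1
    refine Finset.sum_congr rfl fun l hl => ?_
    rw [Function.update_of_ne (Finset.ne_of_mem_erase hl)]
  rw [h, h, succ_nsmul]
  abel

end ConfigurationSpace

/-! ### Poisson moments and the one-dimensional variance estimate. -/

section PoissonMoments

open Real Nat

theorem hasSum_nat_mul_poisson (r : ℝ≥0) :
    HasSum (fun n : ℕ => exp (-r) * r ^ n / n ! * (n : ℝ)) r := by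
  have h := (hasSum_one_poissonMeasure r).mul_left (r : ℝ)
  rw [mul_one] at h
  -- The term `n = 0` vanishes; after the shift, `(n + 1) / (n + 1)! = 1 / n!` leaves `r` times the
  -- total mass.
  refine (hasSum_nat_add_iff' 1).1 ?_
  simp only [Finset.range_one, Finset.sum_singleton, Nat.cast_zero, mul_zero, sub_zero]
  refine h.congr_fun fun n => ?_
  rw [Nat.factorial_succ]
  push_cast
  field_simp
  ring

theorem hasSum_factorialMoment_two_poisson (r : ℝ≥0) :
    HasSum (fun n : ℕ => exp (-r) * r ^ n / n ! * ((n : ℝ) * (n - 1))) (r ^ 2) := by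
  have h := (hasSum_nat_mul_poisson r).mul_left (r : ℝ)
  rw [← sq] at h
  refine (hasSum_nat_add_iff' 1).1 ?_
  simp only [Finset.range_one, Finset.sum_singleton, Nat.cast_zero, zero_mul, mul_zero, sub_zero]
  refine h.congr_fun fun n => ?_
  rw [Nat.factorial_succ]
  push_cast
  field_simp
  ring

theorem integrable_natCast_poissonMeasure (r : ℝ≥0) :
    Integrable (fun n : ℕ => (n : ℝ)) (poissonMeasure r) := by
  rw [integrable_poissonMeasure_iff]
  simpa using (hasSum_nat_mul_poisson r).summable

theorem integral_natCast_poissonMeasure (r : ℝ≥0) :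
    ∫ n : ℕ, (n : ℝ) ∂poissonMeasure r = r := by
  rw [integral_poissonMeasure]
  exact (hasSum_nat_mul_poisson r).tsum_eq

theorem integrable_factorialMoment_two_poissonMeasure (r : ℝ≥0) :
    Integrable (fun n : ℕ => (n : ℝ) * (n - 1)) (poissonMeasure r) := by
  rw [integrable_poissonMeasure_iff]
  refine (hasSum_factorialMoment_two_poisson r).summable.congr fun n => ?_
  rw [Real.norm_of_nonneg]
  rcases n with _ | n
  · simp
  · push_cast; simp; positivity

theorem integral_factorialMoment_two_poissonMeasure (r : ℝ≥0) :
    ∫ n : ℕ, (n : ℝ) * (n - 1) ∂poissonMeasure r = r ^ 2 := by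
  rw [integral_poissonMeasure]
  exact (hasSum_factorialMoment_two_poisson r).tsum_eq

theorem memLp_natCast_poissonMeasure (r : ℝ≥0) :
    MemLp (fun n : ℕ => (n : ℝ)) 2 (poissonMeasure r) := by
  rw [memLp_two_iff_integrable_sq .of_discrete]
  refine ((integrable_factorialMoment_two_poissonMeasure r).add
    (integrable_natCast_poissonMeasure r)).congr (.of_forall fun n => ?_)
  simp only [Pi.add_apply]
  ring

/-- A sequence with increments bounded by one grows at most linearly. -/
theorem abs_sub_zero_le_of_abs_succ_sub_le {g : ℕ → ℝ} (hg : ∀ j, |g (j + 1) - g j| ≤ 1) (j : ℕ) :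
    |g j - g 0| ≤ j := by
  induction j with
  | zero => simp
  | succ j ih =>
    calc |g (j + 1) - g 0| = |(g (j + 1) - g j) + (g j - g 0)| := by ring_nf
      _ ≤ 1 + j := (abs_add_le _ _).trans (add_le_add (hg j) ih)
      _ = ((j + 1 : ℕ) : ℝ) := by push_cast; ring

/-- For small `r`, the variance under the Poisson distribution of a function with increments
bounded by one is close to `r` times the mean square of its increments. -/
theorem abs_variance_sub_le_poissonMeasure (r : ℝ≥0) {g : ℕ → ℝ}
    (hg : ∀ j, |g (j + 1) - g j| ≤ 1) :
    |∫ i, |g i - ∫ j, g j ∂poissonMeasure r| ^ 2 ∂poissonMeasure r -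
        r * ∫ i, |g (i + 1) - g i| ^ 2 ∂poissonMeasure r| ≤ 4 * r ^ 2 := by
  set μ := poissonMeasure r
  set f : ℕ → ℝ := fun i => g i - g 0 with hf
  have hfb (i : ℕ) : |f i| ≤ i := abs_sub_zero_le_of_abs_succ_sub_le hg i
  have hfL : MemLp f 2 μ :=
    (memLp_natCast_poissonMeasure r).mono' .of_discrete (.of_forall hfb)
  have hfi : Integrable f μ := hfL.integrable one_le_two
  have hf2 : Integrable (fun i => f i ^ 2) μ := hfL.integrable_sq
  set d : ℝ := (g 1 - g 0) ^ 2 with hd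
  have hd1 : d ≤ 1 := (sq_le_one_iff_abs_le_one _).2 (hg 0)
  have hd0 : 0 ≤ d := sq_nonneg _
  have hni := integrable_natCast_poissonMeasure r
  have hki := integrable_factorialMoment_two_poissonMeasure r
  -- Variance ignores the constant `g 0`. The constant 4 collects `r²` from the squared mean, `2 r²`
  -- from `hsq`, and `r · r` from `hinc`.
  have hvar : ∫ i, |g i - ∫ j, g j ∂μ| ^ 2 ∂μ = ∫ i, f i ^ 2 ∂μ - (∫ i, f i ∂μ) ^ 2 := by
    have hmean : ∫ j, g j ∂μ = g 0 + ∫ j, f j ∂μ := by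
      have : g = fun j => g 0 + f j := by ext j; simp [hf]
      conv_lhs => rw [this]
      rw [integral_add (integrable_const _) hfi]
      simp
    set a := ∫ j, f j ∂μ
    have : (fun i => |g i - ∫ j, g j ∂μ| ^ 2) = fun i => f i ^ 2 - 2 * a * f i + a ^ 2 := by
      ext i
      rw [hmean, sq_abs, hf]
      ring
    rw [this, integral_add (f := fun i => f i ^ 2 - 2 * a * f i) (hf2.sub (hfi.const_mul _))
        (integrable_const _),
      integral_sub hf2 (hfi.const_mul _), integral_const_mul]
    simp only [integral_const, probReal_univ, smul_eq_mul, one_mul]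
    change _ - 2 * a * a + _ = _
    ring
  have hmean2 : (∫ i, f i ∂μ) ^ 2 ≤ r ^ 2 := by
    have : |∫ i, f i ∂μ| ≤ r := by
      rw [← integral_natCast_poissonMeasure r]
      exact (abs_integral_le_integral_abs).trans (integral_mono hfi.abs hni hfb)
    exact sq_le_sq' (abs_le.1 this).1 (abs_le.1 this).2
  -- With `r = 𝐄[i]`, the integrand `f i ^ 2 - i * d` vanishes at `i = 0, 1`. For `i ≥ 2` it is at
  -- most `i² ≤ 2 i (i - 1)` in absolute value, and the second factorial moment is `r²`.
  have hsq : |∫ i, f i ^ 2 ∂μ - r * d| ≤ 2 * r ^ 2 := by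
    have h1 : ∫ i, f i ^ 2 ∂μ - r * d = ∫ i : ℕ, (f i ^ 2 - i * d) ∂μ := by
      rw [integral_sub hf2 (hni.mul_const d), integral_mul_const, integral_natCast_poissonMeasure]
    rw [h1, ← integral_factorialMoment_two_poissonMeasure r, ← integral_const_mul]
    refine (abs_integral_le_integral_abs).trans
      (integral_mono (hf2.sub (hni.mul_const d)).abs (hki.const_mul 2) fun i => ?_)
    rcases i with _ | _ | i
    · simp [hf]
    · simp [hf, hd]
    · have h2 := sq_le_sq' (abs_le.1 (hfb (i + 2))).1 (abs_le.1 (hfb (i + 2))).2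
      have h3 : (0 : ℝ) ≤ i := Nat.cast_nonneg i
      push_cast at h2 ⊢
      have h4 := sq_nonneg (f (i + 2))
      rw [abs_le]
      constructor <;> nlinarith [mul_le_mul_of_nonneg_left hd1 h3, mul_nonneg hd0 h3]
  -- The squared increment equals `d` at `i = 0` and differs from it by at most `1 ≤ i` afterwards.
  have hinc : |d - ∫ i, |g (i + 1) - g i| ^ 2 ∂μ| ≤ r := by
    have hb (i : ℕ) : |g (i + 1) - g i| ^ 2 ≤ 1 := pow_le_one₀ (abs_nonneg _) (hg i)
    have hbi : Integrable (fun i => |g (i + 1) - g i| ^ 2) μ :=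
      Integrable.of_bound .of_discrete 1 (.of_forall fun i => by
        rw [Real.norm_of_nonneg (by positivity)]; exact hb i)
    have h1 : d - ∫ i, |g (i + 1) - g i| ^ 2 ∂μ = ∫ i, (d - |g (i + 1) - g i| ^ 2) ∂μ := by
      rw [integral_sub (integrable_const _) hbi]
      simp
    rw [h1, ← integral_natCast_poissonMeasure r]
    refine (abs_integral_le_integral_abs).trans
      (integral_mono ((integrable_const d).sub hbi).abs hni fun i => ?_)
    rcases i with _ | i
    · simp [hd]
    · have h3 : (0 : ℝ) ≤ i := Nat.cast_nonneg i
      have h4 := hb (i + 1)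
      have h5 : 0 ≤ |g (i + 1 + 1) - g (i + 1)| ^ 2 := by positivity
      push_cast
      rw [abs_le]
      constructor <;> linarith
  rw [hvar]
  have hr : (0 : ℝ) ≤ r := r.2
  set c := ∫ i, |g (i + 1) - g i| ^ 2 ∂μ
  have h5 : |r * (d - c)| ≤ r ^ 2 := by
    rw [abs_mul, abs_of_nonneg hr, sq]
    exact mul_le_mul_of_nonneg_left hinc hr
  rw [abs_le] at hsq h5 ⊢
  have h6 := sq_nonneg (∫ i, f i ∂μ)
  constructor <;> nlinarith [hsq.1, hsq.2, h5.1, h5.2]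

end PoissonMoments

/-! ### Resampling one coordinate of a product measure. -/

section Resampling

variable {A : Type*} [Fintype A] [DecidableEq A] {E : A → Type*} [∀ a, MeasurableSpace (E a)]

/-- Replacing one coordinate by an independent copy preserves a product of probability measures. -/
theorem measurePreserving_update (P : ∀ a, Measure (E a)) [∀ a, IsProbabilityMeasure (P a)]
    (a : A) :
    MeasurePreserving (fun q : (∀ a, E a) × E a => Function.update q.1 a q.2)
      ((Measure.pi P).prod (P a)) (Measure.pi P) := by
  have hm : Measurable fun q : (∀ a, E a) × E a => Function.update q.1 a q.2 := by
    refine measurable_pi_iff.2 fun b => ?_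
    by_cases h : b = a
    · subst h
      simpa using measurable_snd
    · simp only [Function.update_of_ne h]
      exact (measurable_pi_apply b).comp measurable_fst
  refine ⟨hm, (Measure.pi_eq fun s hs => ?_).symm⟩
  -- The old value of coordinate `a` is discarded, so its factor is the whole space, of mass one.
  have hpre : (fun q : (∀ a, E a) × E a => Function.update q.1 a q.2) ⁻¹' Set.univ.pi s =
      Set.univ.pi (Function.update s a Set.univ) ×ˢ s a := by
    ext ⟨x, y⟩
    simp only [Set.mem_preimage, Set.mem_univ_pi, Set.mem_prod]
    constructor
    · intro h
      refine ⟨fun b => ?_, by simpa using h a⟩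
      by_cases hb : b = a
      · subst hb; simp
      · simpa [Function.update_of_ne hb] using h b
    · rintro ⟨h, hy⟩ b
      by_cases hb : b = a
      · subst hb; simpa using hy
      · simpa [Function.update_of_ne hb] using h b
  rw [Measure.map_apply hm (MeasurableSet.univ_pi hs), hpre, Measure.prod_prod, Measure.pi_pi,
    ← Finset.mul_prod_erase _ _ (Finset.mem_univ a),
    ← Finset.mul_prod_erase _ (fun i => P i (s i)) (Finset.mem_univ a),
    Function.update_self, measure_univ, one_mul, mul_comm]
  congr 1
  refine Finset.prod_congr rfl fun b hb => ?_
  rw [Function.update_of_ne (Finset.ne_of_mem_erase hb)]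

theorem integrable_integral_update (P : ∀ a, Measure (E a)) [∀ a, IsProbabilityMeasure (P a)]
    (a : A) {f : (∀ a, E a) → ℝ} (hf : Integrable f (Measure.pi P)) :
    Integrable (fun x => ∫ y, f (Function.update x a y) ∂P a) (Measure.pi P) :=
  ((measurePreserving_update P a).integrable_comp_of_integrable hf).integral_prod_left

/-- Averaging over one coordinate with the others frozen reduces estimates on the product to
one-dimensional ones. -/
theorem integral_integral_update (P : ∀ a, Measure (E a)) [∀ a, IsProbabilityMeasure (P a)]
    (a : A) {f : (∀ a, E a) → ℝ} (hf : Integrable f (Measure.pi P)) :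
    ∫ x, ∫ y, f (Function.update x a y) ∂P a ∂Measure.pi P = ∫ x, f x ∂Measure.pi P := by
  have hmp := measurePreserving_update P a
  have h1 := integral_prod _ (hmp.integrable_comp_of_integrable hf)
  refine h1.symm.trans ?_
  conv_rhs => rw [← hmp.map_eq]
  rw [integral_map hmp.aemeasurable (by rw [hmp.map_eq]; exact hf.1)]
  rfl

end Resampling

/-! ### The Dirichlet form of independent Poisson coordinates. -/

section PoissonProduct

variable {N : ℕ} (p : Fin N → ℝ≥0)

theorem memLp_eval_poisson (k : Fin N) :
    MemLp (fun m : Fin N → ℕ => (m k : ℝ)) 2 (Measure.pi fun k => poissonMeasure (p k)) :=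
  (memLp_natCast_poissonMeasure (p k)).comp_measurePreserving
    (measurePreserving_eval (fun k => poissonMeasure (p k)) k)

/-- Functions of independent Poisson variables with increments bounded by one: the Dirichlet form
is close to the sum of the mean squares of the increments. -/
theorem abs_dirichletForm_sub_le {G : (Fin N → ℕ) → ℝ}
    (hG : ∀ (m : Fin N → ℕ) (k : Fin N) (j : ℕ),
      |G (Function.update m k (j + 1)) - G (Function.update m k j)| ≤ 1) :
    |dirichletForm (fun k => poissonMeasure (p k)) G -
      ∑ k, p k * ∫ m, |G (Function.update m k (m k + 1)) - G m| ^ 2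
        ∂Measure.pi fun k => poissonMeasure (p k)| ≤ 4 * ∑ k, (p k : ℝ) ^ 2 := by
  set P : Fin N → Measure ℕ := fun k => poissonMeasure (p k) with hPdef
  set μ := Measure.pi P
  -- This linear bound makes the gradient square integrable.
  have hgrad (k : Fin N) (m : Fin N → ℕ) : |discreteGradient P k G m| ≤ m k + p k := by
    set g : ℕ → ℝ := fun j => G (Function.update m k j) with hg
    have hb := abs_sub_zero_le_of_abs_succ_sub_le (g := g) (hG m k)
    have hi : Integrable (fun j => g j - g 0) (P k) :=
      (integrable_natCast_poissonMeasure (p k)).mono' .of_discrete (.of_forall hb)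
    have h1 : discreteGradient P k G m = (g (m k) - g 0) - ∫ j, (g j - g 0) ∂P k := by
      have h2 : ∫ j, g j ∂P k = ∫ j, (g j - g 0) ∂P k + g 0 := by
        have : Integrable g (P k) := by
          exact (hi.add (integrable_const (g 0))).congr (.of_forall fun j => by simp)
        rw [integral_sub this (integrable_const _)]
        simp
      have h3 : g (m k) = G m := by simp [hg]
      rw [discreteGradient, ← h3]
      change g (m k) - ∫ j, g j ∂P k = _
      rw [h2]
      ring
    have h4 : |∫ j, (g j - g 0) ∂P k| ≤ p k := by
      rw [← integral_natCast_poissonMeasure (p k)]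
      exact abs_integral_le_integral_abs.trans
        (integral_mono hi.abs (integrable_natCast_poissonMeasure (p k)) hb)
    rw [h1]
    exact (abs_sub _ _).trans (add_le_add (hb _) h4)
  have hgradi (k : Fin N) : Integrable (fun m => |discreteGradient P k G m| ^ 2) μ := by
    have : MemLp (fun m => |discreteGradient P k G m|) 2 μ :=
      ((memLp_eval_poisson p k).add (memLp_const (p k : ℝ))).mono' .of_discrete
        (.of_forall fun m => by simpa using hgrad k m)
    exact this.integrable_sq
  have hinc (m : Fin N → ℕ) (k : Fin N) : |G (Function.update m k (m k + 1)) - G m| ≤ 1 := by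
    simpa using hG m k (m k)
  have hinci (k : Fin N) :
      Integrable (fun m => |G (Function.update m k (m k + 1)) - G m| ^ 2) μ :=
    Integrable.of_bound .of_discrete 1 (.of_forall fun m => by
      rw [Real.norm_of_nonneg (by positivity)]
      exact pow_le_one₀ (abs_nonneg _) (hinc m k))
  rw [dirichletForm, integral_finsetSum _ fun k _ => hgradi k, ← Finset.sum_sub_distrib,
    Finset.mul_sum]
  refine (Finset.abs_sum_le_sum_abs _ _).trans (Finset.sum_le_sum fun k _ => ?_)
  -- Once coordinate `k` is averaged in both integrals, the one-dimensional estimate applies for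
  -- each frozen `m`.
  rw [← integral_integral_update P k (hgradi k), ← integral_integral_update P k (hinci k),
    ← integral_const_mul, ← integral_sub (integrable_integral_update P k (hgradi k))
      ((integrable_integral_update P k (hinci k)).const_mul _)]
  rw [← Real.norm_eq_abs]
  refine (norm_integral_le_of_norm_le_const (μ := μ) (C := 4 * (p k : ℝ) ^ 2)
    (.of_forall fun m => ?_)).trans_eq (by rw [probReal_univ, mul_one])
  have := abs_variance_sub_le_poissonMeasure (p k) (g := fun j => G (Function.update m k j)) (hG m k)
  simpa [discreteGradient, hPdef] using this

variable {Y : Type*} [MeasurableSpace Y]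

/-- Comparison with the empty configuration gives `|F (U m)| ≤ |F 0| + ∑ m_k`, and Poisson variables
are square integrable. -/
theorem TVLip.memLp_comp_toConfiguration [TopologicalSpace Y] [OpensMeasurableSpace Y]
    {F : Configuration Y → ℝ} (hF : TVLip F) (ζ : Fin N → Y) :
    MemLp (F ∘ toConfiguration ζ) 2 (Measure.pi fun k => poissonMeasure (p k)) := by
  have h : MemLp (fun m : Fin N → ℕ => |F 0| + ∑ k, (m k : ℝ)) 2
      (Measure.pi fun k => poissonMeasure (p k)) := by
    have h1 : MemLp (fun m : Fin N → ℕ => ∑ k, (m k : ℝ)) 2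
        (Measure.pi fun k => poissonMeasure (p k)) :=
      memLp_finsetSum (f := fun k (m : Fin N → ℕ) => (m k : ℝ)) Finset.univ
        fun k _ => memLp_eval_poisson p k
    exact MemLp.add (f := fun _ => |F 0|) (g := fun m : Fin N → ℕ => ∑ k, (m k : ℝ))
      (memLp_const _) h1
  refine h.mono' .of_discrete (.of_forall fun m => ?_)
  have h1 := (hF.abs_sub_le _ _).trans (distTV_add_left_le 0 (toConfiguration ζ m))
  have h2 := evalHom_toConfiguration MeasurableSet.univ ζ m
  rw [evalHom_apply] at h2
  rw [h2, zero_add] at h1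
  simp only [Set.indicator_univ, Pi.one_apply, mul_one] at h1
  have h3 := abs_add_le (F (toConfiguration ζ m) - F 0) (F 0)
  rw [sub_add_cancel] at h3
  rw [Real.norm_eq_abs, Function.comp_apply]
  linarith

theorem TVLip.abs_imageDirichletForm_sub_le [TopologicalSpace Y] [OpensMeasurableSpace Y]
    {F : Configuration Y → ℝ} (hF : TVLip F) (ζ : Fin N → Y) :
    |imageDirichletForm (fun k => poissonMeasure (p k)) (toConfiguration ζ) F -
      ∑ k, p k * ∫ m, |differenceGradient (ζ k) F (toConfiguration ζ m)| ^ 2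
        ∂Measure.pi fun k => poissonMeasure (p k)| ≤ 4 * ∑ k, (p k : ℝ) ^ 2 := by
  have h := abs_dirichletForm_sub_le p (G := F ∘ toConfiguration ζ) fun m k j => by
    simp only [Function.comp_apply, toConfiguration_update_succ]
    exact hF.abs_add_pointMass_sub_le _ _
  simpa only [imageDirichletForm, Function.comp_apply, toConfiguration_update_succ,
    Function.update_eq_self, differenceGradient] using h

end PoissonProduct

/-! ### Characteristic functionals of random configurations. -/

section CharacteristicFunctional

variable {Y : Type*} [MeasurableSpace Y]

/-- The step function `∑ s ∈ I, t s • 1_s`. -/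
def stepFun (I : Finset {s : Set Y // MeasurableSet s}) (t : I → ℝ) (x : Y) : ℝ :=
  ∑ s : I, t s * (s : Set Y).indicator (1 : Y → ℝ) x

theorem measurable_stepFun (I : Finset {s : Set Y // MeasurableSet s}) (t : I → ℝ) :
    Measurable (stepFun I t) :=
  Finset.measurable_fun_sum _ fun s _ => (measurable_one.indicator s.1.2).const_mul _

/-- The characteristic functional `𝐄 [exp (i ∑ s ∈ I, t s ω(s))]` of the law of a random
configuration. -/
def charFunctional (P : Measure (Configuration Y)) (I : Finset {s : Set Y // MeasurableSet s})
    (t : I → ℝ) : ℂ :=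
  ∫ ω, Complex.exp (((∑ s : I, t s * evalHom (s : Set Y) ω : ℝ) : ℂ) * Complex.I) ∂P

/-- The evaluations generate the σ-field, so their joint law determines the measure. -/
theorem measure_ext_of_apply {P Q : Measure (Configuration Y)}
    (h : P.map (fun ω (s : {s : Set Y // MeasurableSet s}) => evalHom (s : Set Y) ω) =
      Q.map (fun ω (s : {s : Set Y // MeasurableSet s}) => evalHom (s : Set Y) ω)) : P = Q := by
  set Φ : Configuration Y → {s : Set Y // MeasurableSet s} → ℝ := fun ω s => evalHom (s : Set Y) ω
  have hΦ : Measurable Φ := measurable_pi_iff.2 fun s => measurable_evalHom s.2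
  have hle : (inferInstance : MeasurableSpace (Configuration Y)) ≤
      MeasurableSpace.comap Φ inferInstance := by
    have hid : @Measurable _ _ (MeasurableSpace.comap Φ inferInstance) _
        (id : Configuration Y → Configuration Y) := by
      let _ : MeasurableSpace (Configuration Y) := MeasurableSpace.comap Φ inferInstance
      refine measurable_configuration_of_measurable_apply fun s hs => ?_
      have h1 : Measurable fun ω : Configuration Y => ENNReal.ofReal (Φ ω ⟨s, hs⟩) :=
        ((measurable_pi_apply (⟨s, hs⟩ : {s : Set Y // MeasurableSet s})).comp
          (comap_measurable Φ)).ennreal_ofReal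
      convert h1 using 2 with ω
      simp [Φ, evalHom_apply]
    exact fun s hs => hid hs
  ext s hs
  obtain ⟨B, hB, rfl⟩ := hle s hs
  rw [← Measure.map_apply hΦ hB, h, Measure.map_apply hΦ hB]

/-- Characteristic functions determine the finite-dimensional laws of the evaluations, and these
determine their joint law by uniqueness of projective limits. -/
theorem measure_ext_of_charFunctional {P Q : Measure (Configuration Y)} [IsProbabilityMeasure P]
    [IsProbabilityMeasure Q] (h : ∀ I t, charFunctional P I t = charFunctional Q I t) : P = Q := by
  refine measure_ext_of_apply ?_
  set Φ : Configuration Y → {s : Set Y // MeasurableSet s} → ℝ := fun ω s => evalHom (s : Set Y) ω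
  have hΦ : Measurable Φ := measurable_pi_iff.2 fun s => measurable_evalHom s.2
  have : IsProbabilityMeasure (P.map Φ) := Measure.isProbabilityMeasure_map hΦ.aemeasurable
  have : IsProbabilityMeasure (Q.map Φ) := Measure.isProbabilityMeasure_map hΦ.aemeasurable
  have hr (I : Finset {s : Set Y // MeasurableSet s}) :
      Measurable (I.restrict : ({s : Set Y // MeasurableSet s} → ℝ) → (I → ℝ)) :=
    Finset.measurable_restrict I
  refine IsProjectiveLimit.unique (P := fun I => (Q.map Φ).map I.restrict) (fun I => ?_)
    fun I => rfl
  refine Measure.ext_of_charFunDual (funext fun L => ?_)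
  have key (R : Measure (Configuration Y)) : charFunDual ((R.map Φ).map I.restrict) L =
      charFunctional R I fun s => L (Pi.single s 1) := by
    rw [charFunDual_apply, Measure.map_map (hr I) hΦ, integral_map ((hr I).comp hΦ).aemeasurable
      (by fun_prop), charFunctional]
    refine integral_congr_ae (.of_forall fun ω => ?_)
    simp only
    congr 3
    rw [← ContinuousLinearMap.coe_coe, LinearMap.pi_apply_eq_sum_univ]
    refine Finset.sum_congr rfl fun s _ => ?_
    have hs : (fun j => if s = j then (1 : ℝ) else 0) = Pi.single s 1 := by
      ext j
      simp [Pi.single_apply, eq_comm]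
    rw [hs, smul_eq_mul, mul_comm]
    rfl
  rw [key, key, h]

theorem integral_comp_eq_sum_preimage {Ω K : Type*} [MeasurableSpace Ω] [Fintype K]
    [MeasurableSpace K] [MeasurableSingletonClass K] (μ : Measure Ω) [IsFiniteMeasure μ]
    {h : Ω → K} (hh : Measurable h) (g : K → ℂ) :
    ∫ x, g (h x) ∂μ = ∑ k, (μ.real (h ⁻¹' {k}) : ℂ) * g k := by
  have := Measure.isFiniteMeasure_map μ h
  rw [← integral_map hh.aemeasurable (f := g) .of_discrete, integral_fintype .of_finite]
  refine Finset.sum_congr rfl fun k _ => ?_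
  rw [map_measureReal_apply hh (measurableSet_singleton k)]
  simp

theorem integral_exp_natCast_poissonMeasure (r : ℝ≥0) (t : ℝ) :
    ∫ n : ℕ, Complex.exp ((t * n : ℝ) * Complex.I) ∂poissonMeasure r =
      Complex.exp (r * (Complex.exp (t * Complex.I) - 1)) := by
  rw [← charFun_map_cast_poissonMeasure, charFun_apply_real,
    integral_map .of_discrete (by fun_prop)]
  simp

/-- The sets of `I` may overlap, so they are cut into the atoms of the finite partition they
generate. Counts on atoms are independent Poisson variables, and the step function is constant on
each atom. -/
theorem IsPoissonPointProcess.charFunctional_eq {M : Measure Y} [IsFiniteMeasure M]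
    {P : Measure (Configuration Y)} (hP : IsPoissonPointProcess M P)
    (I : Finset {s : Set Y // MeasurableSet s}) (t : I → ℝ) :
    charFunctional P I t =
      Complex.exp (∫ x, (Complex.exp (stepFun I t x * Complex.I) - 1) ∂M) := by
  classical
  -- `h x` records which sets of `I` contain `x`; its fibres are the atoms, possibly empty.
  set h : Y → I → Bool := fun x s => decide (x ∈ (s : Set Y)) with hh
  have hm : Measurable h := measurable_pi_iff.2 fun s => by
    refine measurable_to_bool ?_
    convert s.1.2 using 1
    ext x
    simp [hh]
  set n := Fintype.card (I → Bool)
  let e : Fin n ≃ (I → Bool) := (Fintype.equivFin _).symm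
  set B : Fin n → Set Y := fun i => h ⁻¹' {e i} with hB
  have hBm (i : Fin n) : MeasurableSet (B i) := hm (measurableSet_singleton _)
  have hBd : Pairwise fun i j => Disjoint (B i) (B j) := by
    intro i j hij
    refine Disjoint.preimage _ (Set.disjoint_singleton.2 fun hc => hij (e.injective hc))
  set c : (I → Bool) → ℝ := fun b => ∑ s : I, if b s then t s else 0 with hc
  have hstep (x : Y) : stepFun I t x = c (h x) := by
    refine Finset.sum_congr rfl fun s _ => ?_
    simp only [hh, decide_eq_true_eq]
    by_cases hx : x ∈ (s : Set Y)
    · rw [Set.indicator_of_mem hx, if_pos hx]; simp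
    · rw [Set.indicator_of_notMem hx, if_neg hx]; simp
  have hsum (ω : Configuration Y) :
      ∑ s : I, t s * evalHom (s : Set Y) ω = ∑ i, c (e i) * (ω.count (B i) : ℝ) := by
    have h1 (s : I) : evalHom (s : Set Y) ω =
        ∑ i, if e i s then evalHom (B i) ω else 0 := by
      have hpre : (s : Set Y) = ⋃ i ∈ Finset.univ.filter fun i => e i s, B i := by
        ext x
        simp only [Finset.mem_filter, Finset.mem_univ, true_and, Set.mem_iUnion, hB,
          Set.mem_preimage, Set.mem_singleton_iff, exists_prop]
        constructor
        · intro hx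
          exact ⟨e.symm (h x), by simpa [hh] using hx, by simp⟩
        · rintro ⟨i, hi, hx⟩
          rw [← hx] at hi
          simpa [hh] using hi
      rw [← Finset.sum_filter]
      conv_lhs => rw [hpre]
      simp only [evalHom_apply]
      exact measureReal_biUnion_finset (fun i _ j _ hij => hBd hij) fun i _ => hBm i
    simp_rw [h1, ← evalHom_eq_count (hBm _), hc, Finset.sum_mul, Finset.mul_sum]
    rw [Finset.sum_comm]
    refine Finset.sum_congr rfl fun i _ => Finset.sum_congr rfl fun s _ => ?_
    split_ifs <;> simp
  have hind := (hP.iIndepFun_count n B hBm hBd).comp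
    (fun i (j : ℕ) => Complex.exp ((c (e i) * j : ℝ) * Complex.I)) fun i => .of_discrete
  have hcount (i : Fin n) : AEMeasurable (fun ω : Configuration Y => ω.count (B i)) P :=
    (hP.hasLaw_count (B i) (hBm i)).aemeasurable
  calc charFunctional P I t
      = ∫ ω : Configuration Y, ∏ i, Complex.exp ((c (e i) * (ω.count (B i)) : ℝ) * Complex.I)
          ∂P := by
        refine integral_congr_ae (.of_forall fun ω => ?_)
        simp only
        rw [hsum, ← Complex.exp_sum, ← Finset.sum_mul]
        push_cast
        rfl
    _ = ∏ i, ∫ ω : Configuration Y, Complex.exp ((c (e i) * (ω.count (B i)) : ℝ) * Complex.I)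
          ∂P :=
        hind.integral_fun_prod_eq_prod_integral fun i =>
          (Measurable.of_discrete.comp_aemeasurable (hcount i)).aestronglyMeasurable
    _ = ∏ i, Complex.exp ((M.real (B i) : ℂ) * (Complex.exp (c (e i) * Complex.I) - 1)) := by
        refine Finset.prod_congr rfl fun i _ => ?_
        have h2 := integral_exp_natCast_poissonMeasure (M (B i)).toNNReal (c (e i))
        rw [← (hP.hasLaw_count (B i) (hBm i)).map_eq,
          integral_map (hcount i) .of_discrete] at h2
        exact h2
    _ = _ := by
        simp_rw [hstep]
        rw [integral_comp_eq_sum_preimage M hm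
          (fun b => Complex.exp ((c b : ℝ) * Complex.I) - 1), ← Complex.exp_sum, ← e.sum_comp]

end CharacteristicFunctional

/-! ### Poisson processes as a Poisson number of i.i.d. points. -/

section Mixture

variable {Y : Type*} [MeasurableSpace Y]

/-- The law of `∑ j < n, ε_{x_j}`, where `n` is a Poisson variable of parameter `a` and the points
`x_j` are independent of law `π`. -/
def poissonMixture (a : ℝ≥0) (π : Measure Y) : Measure (Configuration Y) :=
  Measure.sum fun n : ℕ => poissonMeasure a {n} • (Measure.pi fun _ : Fin n => π).map diracSum

variable (a : ℝ≥0) (π : Measure Y) [IsProbabilityMeasure π]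

instance : IsProbabilityMeasure (poissonMixture a π) := by
  constructor
  have (n : ℕ) : IsProbabilityMeasure ((Measure.pi fun _ : Fin n => π).map diracSum) :=
    Measure.isProbabilityMeasure_map measurable_diracSum.aemeasurable
  simp only [poissonMixture, Measure.sum_apply _ MeasurableSet.univ, Measure.smul_apply,
    measure_univ, smul_eq_mul, mul_one]
  have h := Measure.tsum_indicator_apply_singleton (poissonMeasure a) Set.univ MeasurableSet.univ
  simpa using h

theorem integral_poissonMixture {E : Type*} [NormedAddCommGroup E] [NormedSpace ℝ E]
    {f : Configuration Y → E} (hf : StronglyMeasurable f) (C : ℝ) (hC : ∀ ω, ‖f ω‖ ≤ C) :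
    ∫ ω, f ω ∂poissonMixture a π =
      ∑' n : ℕ, (poissonMeasure a).real {n} • ∫ x, f (diracSum x) ∂Measure.pi fun _ : Fin n => π := by
  have hi : Integrable f (poissonMixture a π) :=
    Integrable.of_bound hf.aestronglyMeasurable C (.of_forall hC)
  rw [poissonMixture] at hi ⊢
  rw [integral_sum_measure hi]
  refine tsum_congr fun n => ?_
  rw [integral_smul_measure, integral_map measurable_diracSum.aemeasurable hf.aestronglyMeasurable,
    measureReal_def]

theorem sum_evalHom_diracSum (I : Finset {s : Set Y // MeasurableSet s}) (t : I → ℝ) {n : ℕ}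
    (x : Fin n → Y) :
    ∑ s : I, t s * evalHom (s : Set Y) (diracSum x) = ∑ j, stepFun I t (x j) := by
  simp_rw [evalHom_diracSum (Subtype.prop _), stepFun, Finset.mul_sum]
  exact Finset.sum_comm

/-- Given `n` points, independence yields `z ^ n`, where `z` is the mean of `exp (i · stepFun)`
under `π`; the Poisson average of `z ^ n` is `exp (a (z - 1))`. -/
theorem charFunctional_poissonMixture (I : Finset {s : Set Y // MeasurableSet s}) (t : I → ℝ) :
    charFunctional (poissonMixture a π) I t =
      Complex.exp (a * ∫ x, (Complex.exp (stepFun I t x * Complex.I) - 1) ∂π) := by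
  have hm : Measurable fun ω : Configuration Y =>
      Complex.exp (((∑ s : I, t s * evalHom (s : Set Y) ω : ℝ) : ℂ) * Complex.I) := by
    refine Complex.measurable_exp.comp ((Complex.measurable_ofReal.comp ?_).mul_const _)
    exact Finset.measurable_fun_sum _ fun s _ => (measurable_evalHom s.1.2).const_mul _
  set f : Y → ℂ := fun x => Complex.exp (stepFun I t x * Complex.I) with hf
  have hfi : Integrable f π := by
    refine Integrable.of_bound (C := 1) ?_ (.of_forall fun x => ?_)
    · exact (Complex.measurable_exp.comp ((Complex.measurable_ofReal.comp
        (measurable_stepFun I t)).mul_const _)).aestronglyMeasurable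
    · rw [hf, Complex.norm_exp_ofReal_mul_I]
  set z := ∫ x, f x ∂π
  have hz : ∫ x, (f x - 1) ∂π = z - 1 := by
    rw [integral_sub hfi (integrable_const _)]
    simp [z]
  rw [charFunctional, integral_poissonMixture a π hm.stronglyMeasurable 1
    fun ω => (Complex.norm_exp_ofReal_mul_I _).le, hz]
  have h1 (n : ℕ) : ∫ x : Fin n → Y,
      Complex.exp (((∑ s : I, t s * evalHom (s : Set Y) (diracSum x) : ℝ) : ℂ) * Complex.I)
        ∂(Measure.pi fun _ : Fin n => π) = z ^ n := by
    simp_rw [sum_evalHom_diracSum]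
    push_cast
    simp_rw [Finset.sum_mul, Complex.exp_sum]
    rw [integral_fintype_prod_eq_pow (ι := Fin n) f]
    simp [z]
  simp_rw [h1, poissonMeasure_real_singleton]
  calc ∑' n : ℕ, (Real.exp (-a) * a ^ n / n.factorial) • z ^ n
      = ∑' n : ℕ, Complex.exp (-a) * ((a * z) ^ n / n.factorial) := by
        refine tsum_congr fun n => ?_
        rw [Complex.real_smul]
        push_cast
        ring
    _ = Complex.exp (-a) * Complex.exp (a * z) := by
        rw [tsum_mul_left, (NormedSpace.expSeries_div_hasSum_exp ((a : ℂ) * z)).tsum_eq,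
          Complex.exp_eq_exp_ℂ]
    _ = _ := by
        rw [← Complex.exp_add]
        ring_nf

theorem IsPoissonPointProcess.eq_poissonMixture {P : Measure (Configuration Y)}
    [IsProbabilityMeasure P] (hP : IsPoissonPointProcess π P) : P = poissonMixture 1 π :=
  measure_ext_of_charFunctional fun I t => by
    rw [hP.charFunctional_eq, charFunctional_poissonMixture]
    simp

/-- The evaluations are linear in the independent `m_k`, with coefficients `stepFun I t (ζ k)`, so
the Poisson characteristic functions multiply. Coincident points `ζ_k` cause no difficulty. -/
theorem charFunctional_map_toConfiguration {N : ℕ} (ζ : Fin N → Y) (p : Fin N → ℝ≥0)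
    (I : Finset {s : Set Y // MeasurableSet s}) (t : I → ℝ) :
    charFunctional ((Measure.pi fun k => poissonMeasure (p k)).map (toConfiguration ζ)) I t =
      Complex.exp (∑ k, p k * (Complex.exp (stepFun I t (ζ k) * Complex.I) - 1)) := by
  have hm : Measurable fun ω : Configuration Y =>
      Complex.exp (((∑ s : I, t s * evalHom (s : Set Y) ω : ℝ) : ℂ) * Complex.I) := by
    refine Complex.measurable_exp.comp ((Complex.measurable_ofReal.comp ?_).mul_const _)
    exact Finset.measurable_fun_sum _ fun s _ => (measurable_evalHom s.1.2).const_mul _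
  rw [charFunctional, integral_map .of_discrete hm.aestronglyMeasurable, Complex.exp_sum]
  simp_rw [← integral_exp_natCast_poissonMeasure]
  rw [← integral_fintype_prod_eq_prod
    (fun k (j : ℕ) => Complex.exp ((stepFun I t (ζ k) * j : ℝ) * Complex.I))]
  refine integral_congr_ae (.of_forall fun m => ?_)
  simp only
  rw [← Complex.exp_sum, ← Finset.sum_mul, ← Complex.ofReal_sum]
  congr 3
  simp_rw [evalHom_toConfiguration (Subtype.prop _), stepFun, Finset.mul_sum, Finset.sum_mul]
  rw [Finset.sum_comm]
  exact Finset.sum_congr rfl fun k _ => Finset.sum_congr rfl fun s _ => by ring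

end Mixture

/-! ### Discrete intensities and passage to the limit. -/

section Limit

variable {Y : Type*} [MeasurableSpace Y]

theorem integral_integral_poissonMixture (a : ℝ≥0) (π : Measure Y) [IsProbabilityMeasure π]
    {H : Configuration Y × Y → ℝ} (hH : Measurable H) (C : ℝ) (hC : ∀ q, |H q| ≤ C) :
    ∫ ω, ∫ x, H (ω, x) ∂π ∂poissonMixture a π =
      ∑' n : ℕ, (poissonMeasure a).real {n} *
        ∫ q, H (diracSum q.1, q.2) ∂(Measure.pi fun _ : Fin n => π).prod π := by
  rw [integral_poissonMixture a π
    (StronglyMeasurable.integral_prod_right (f := fun ω x => H (ω, x)) hH.stronglyMeasurable) C]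
  · refine tsum_congr fun n => ?_
    rw [integral_prod, smul_eq_mul]
    exact Integrable.of_bound (hH.comp ((measurable_diracSum.comp measurable_fst).prodMk
      measurable_snd)).aestronglyMeasurable C (.of_forall fun q => hC _)
  · intro ω
    refine (norm_integral_le_of_norm_le_const (μ := π) (C := C)
      (.of_forall fun x => hC (ω, x))).trans_eq (by rw [probReal_univ, mul_one])

/-- Normalising the discrete intensity allows weak convergence of probability measures to be used.
If the total mass is zero, any probability measure serves. -/
theorem exists_smul_eq_sum_dirac [Nonempty Y] {N : ℕ} (ζ : Fin N → Y) (p : Fin N → ℝ≥0) :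
    ∃ π : ProbabilityMeasure Y,
      (∑ k, p k) • (π : Measure Y) = ∑ k, p k • Measure.dirac (ζ k) := by
  rcases eq_or_ne (∑ k, p k) 0 with h | h
  · refine ⟨⟨Measure.dirac (Classical.arbitrary Y), inferInstance⟩, ?_⟩
    rw [h, zero_smul]
    refine (Finset.sum_eq_zero fun k hk => ?_).symm
    rw [Finset.sum_eq_zero_iff.1 h k hk, zero_smul]
  · refine ⟨⟨(∑ k, p k)⁻¹ • ∑ k, p k • Measure.dirac (ζ k), ⟨?_⟩⟩, ?_⟩
    · simp only [Measure.smul_apply, Measure.coe_finsetSum, Finset.sum_apply, measure_univ]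
      simp only [ENNReal.smul_def, smul_eq_mul, mul_one]
      rw [← ENNReal.ofNNReal_finsetSum, ← ENNReal.coe_mul, inv_mul_cancel₀ h, ENNReal.coe_one]
    · rw [ProbabilityMeasure.coe_mk, smul_smul, mul_inv_cancel₀ h, one_smul]

theorem mul_integral_eq_sum_of_smul_eq [MeasurableSingletonClass Y] {𝕜 : Type*} [RCLike 𝕜]
    {N : ℕ} {ζ : Fin N → Y} {p : Fin N → ℝ≥0} {π : Measure Y}
    (h : (∑ k, p k) • π = ∑ k, p k • Measure.dirac (ζ k)) (f : Y → 𝕜) :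
    (((∑ k, p k : ℝ≥0) : ℝ) : 𝕜) * ∫ x, f x ∂π = ∑ k, ((p k : ℝ) : 𝕜) * f (ζ k) := by
  have h1 := congrArg (fun μ : Measure Y => ∫ x, f x ∂μ) h
  simp only [integral_smul_nnreal_measure] at h1
  rw [integral_finsetSum_measure fun k _ => (integrable_dirac (by simp)).smul_measure_nnreal] at h1
  simp only [integral_smul_nnreal_measure, integral_dirac] at h1
  simpa only [NNReal.smul_def, RCLike.real_smul_eq_coe_mul] using h1

/-- Both characteristic functionals are the exponential of the integral of `exp (i · stepFun) - 1`
against the same intensity. -/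
theorem map_toConfiguration_eq_poissonMixture [MeasurableSingletonClass Y] {N : ℕ} {ζ : Fin N → Y}
    {p : Fin N → ℝ≥0} {π : Measure Y} [IsProbabilityMeasure π]
    (h : (∑ k, p k) • π = ∑ k, p k • Measure.dirac (ζ k)) :
    (Measure.pi fun k => poissonMeasure (p k)).map (toConfiguration ζ) =
      poissonMixture (∑ k, p k) π := by
  have : IsProbabilityMeasure
      ((Measure.pi fun k => poissonMeasure (p k)).map (toConfiguration ζ)) :=
    Measure.isProbabilityMeasure_map .of_discrete
  refine measure_ext_of_charFunctional fun I t => ?_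
  rw [charFunctional_map_toConfiguration, charFunctional_poissonMixture]
  congr 1
  exact (mul_integral_eq_sum_of_smul_eq (𝕜 := ℂ) h
    fun x => Complex.exp (stepFun I t x * Complex.I) - 1).symm

/-- Finite products of probability measures depend continuously on their factors for weak
convergence. -/
theorem tendsto_probabilityMeasure_prod_pi [TopologicalSpace Y] [PolishSpace Y] [BorelSpace Y]
    {π : ℕ → ProbabilityMeasure Y} {M : ProbabilityMeasure Y} (h : Tendsto π atTop (𝓝 M)) (n : ℕ)
    {f : (Fin n → Y) × Y → ℝ} (hf : Continuous f) (C : ℝ) (hC : ∀ q, |f q| ≤ C) :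
    Tendsto (fun N => ∫ q, f q ∂(Measure.pi fun _ : Fin n => (π N : Measure Y)).prod (π N)) atTop
      (𝓝 (∫ q, f q ∂(Measure.pi fun _ : Fin n => (M : Measure Y)).prod M)) := by
  have h1 : Continuous fun μ : ProbabilityMeasure Y =>
      (ProbabilityMeasure.pi fun _ : Fin n => μ).prod μ :=
    ProbabilityMeasure.continuous_prod.comp
      ((ProbabilityMeasure.continuous_pi.comp (continuous_pi fun _ => continuous_id)).prodMk
        continuous_id)
  exact ProbabilityMeasure.tendsto_iff_forall_integral_tendsto.1 ((h1.tendsto M).comp h)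
    (BoundedContinuousFunction.ofNormedAddCommGroup f hf C hC)

/-- If `a N → 1` and the laws `π N` converge weakly to `M`, the Poisson mixtures of parameters
`a N`, `π N` converge to the Poisson mixture of parameters `1`, `M`, in the sense of the integrals of
bounded continuous functions of a configuration and a point. -/
theorem tendsto_integral_integral_poissonMixture [TopologicalSpace Y] [PolishSpace Y] [BorelSpace Y]
    {π : ℕ → ProbabilityMeasure Y} {M : ProbabilityMeasure Y} (h : Tendsto π atTop (𝓝 M))
    {a : ℕ → ℝ≥0} (ha : Tendsto a atTop (𝓝 1)) {H : Configuration Y × Y → ℝ} (hH : Measurable H)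
    (hHc : Continuous H) (C : ℝ) (hC : ∀ q, |H q| ≤ C) :
    Tendsto (fun N => ∫ ω, ∫ x, H (ω, x) ∂(π N : Measure Y) ∂poissonMixture (a N) (π N : Measure Y))
      atTop (𝓝 (∫ ω, ∫ x, H (ω, x) ∂(M : Measure Y) ∂poissonMixture 1 (M : Measure Y))) := by
  simp_rw [integral_integral_poissonMixture _ _ hH C hC]
  have ha' : Tendsto (fun N => (a N : ℝ)) atTop (𝓝 ((1 : ℝ≥0) : ℝ)) :=
    (NNReal.continuous_coe.tendsto 1).comp ha
  -- Since `a N → 1`, eventually `a N < 2`, whence the Poisson weights are at most `2 ^ n / n!`.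
  refine tendsto_tsum_of_dominated_convergence (bound := fun n : ℕ => 2 ^ n / n.factorial * C)
    ((Real.summable_pow_div_factorial 2).mul_right C) (fun n => ?_) ?_
  · refine Tendsto.mul ?_ (tendsto_probabilityMeasure_prod_pi h n
      (hHc.comp ((continuous_diracSum.comp continuous_fst).prodMk continuous_snd)) C fun q => hC _)
    simp_rw [poissonMeasure_real_singleton]
    exact (((Real.continuous_exp.tendsto _).comp ha'.neg).mul (ha'.pow n)).div_const _
  · filter_upwards [ha.eventually (gt_mem_nhds (one_lt_two : (1 : ℝ≥0) < 2))] with N hN n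
    rw [norm_mul]
    refine mul_le_mul ?_ ?_ (norm_nonneg _) (by positivity)
    · rw [Real.norm_of_nonneg measureReal_nonneg, poissonMeasure_real_singleton]
      have h2 : (a N : ℝ) ≤ 2 := by exact_mod_cast hN.le
      have h3 : Real.exp (-(a N : ℝ)) ≤ 1 := Real.exp_le_one_iff.2 (by simp)
      gcongr
      calc Real.exp (-(a N : ℝ)) * (a N : ℝ) ^ n ≤ 1 * 2 ^ n := by gcongr
        _ = 2 ^ n := one_mul _
    · exact (norm_integral_le_of_norm_le_const (C := C)
        (.of_forall fun q => hC _)).trans_eq (by rw [probReal_univ, mul_one])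

/-- The sum of squares is at most `(sup p_k) ∑ p_k`, where the first factor tends to 0 and the
second converges. -/
theorem tendsto_sum_sq_of_isBigO {p : (N : ℕ) → Fin N → ℝ≥0}
    (hp : (fun N : ℕ => ⨆ k : Fin N, (p N k : ℝ)) =O[atTop] (fun N : ℕ => 1 / (N : ℝ)))
    {b : ℝ} (hs : Tendsto (fun N => ∑ k, (p N k : ℝ)) atTop (𝓝 b)) :
    Tendsto (fun N => ∑ k, (p N k : ℝ) ^ 2) atTop (𝓝 0) := by
  have h0 : Tendsto (fun N : ℕ => ⨆ k : Fin N, (p N k : ℝ)) atTop (𝓝 0) :=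
    hp.trans_tendsto tendsto_one_div_atTop_nhds_zero_nat
  have h1 := h0.mul hs
  rw [zero_mul] at h1
  refine squeeze_zero (fun N => Finset.sum_nonneg fun k _ => by positivity) (fun N => ?_) h1
  rw [Finset.mul_sum]
  refine Finset.sum_le_sum fun k _ => ?_
  rw [sq]
  exact mul_le_mul_of_nonneg_right
    (le_ciSup (f := fun k => (p N k : ℝ)) (Set.finite_range _).bddAbove k) (p N k).2

end Limit

end PoissonDirichlet

end

theorem mainTheorem7 {Y : Type*} [TopologicalSpace Y] [CompactSpace Y] [PolishSpace Y]
    [MeasurableSpace Y] [BorelSpace Y]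
    (M : Measure Y) [IsProbabilityMeasure M]
    (P : Measure (PoissonDirichlet.Configuration Y)) [IsProbabilityMeasure P]
    (hP : PoissonDirichlet.IsPoissonPointProcess M P)
    (ζ : (N : ℕ) → Fin N → Y) (p : (N : ℕ) → Fin N → ℝ≥0)
    (hp : (fun N : ℕ => ⨆ k : Fin N, (p N k : ℝ)) =O[atTop] (fun N : ℕ => 1 / (N : ℝ)))
    (hζ : ∀ f : Y → ℝ, Continuous f → Integrable f M →
      Tendsto (fun N : ℕ => ∑ k : Fin N, f (ζ N k) * (p N k : ℝ)) atTop (𝓝 (∫ x, f x ∂M)))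
    (F : PoissonDirichlet.Configuration Y → ℝ) (hF : PoissonDirichlet.TVLip F)
    (hFP : PoissonDirichlet.InPoissonDomain M P F) :
    (∀ N : ℕ, PoissonDirichlet.InDomain (fun k : Fin N => poissonMeasure (p N k))
      (F ∘ PoissonDirichlet.toConfiguration (ζ N))) ∧
    Tendsto (fun N : ℕ => PoissonDirichlet.imageDirichletForm
        (fun k : Fin N => poissonMeasure (p N k)) (PoissonDirichlet.toConfiguration (ζ N)) F)
      atTop (𝓝 (PoissonDirichlet.poissonDirichletForm M P F)) := by
  open PoissonDirichlet in
  refine ⟨fun N => hF.memLp_comp_toConfiguration (p N) (ζ N), ?_⟩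
  have : Nonempty Y := nonempty_of_isProbabilityMeasure M
  choose π hπ using fun N => exists_smul_eq_sum_dirac (ζ N) (p N)
  set a : ℕ → ℝ≥0 := fun N => ∑ k, p N k with ha_def
  -- The test function 1 gives convergence of the total masses to `M(Y) = 1`.
  have hsum : Tendsto (fun N => ∑ k, (p N k : ℝ)) atTop (𝓝 1) := by
    simpa using hζ (fun _ => 1) continuous_const (integrable_const _)
  have har : Tendsto (fun N => (a N : ℝ)) atTop (𝓝 1) := by
    simpa [ha_def] using hsum
  have ha : Tendsto a atTop (𝓝 1) := NNReal.tendsto_coe.1 (by simpa using har)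
  -- The assumed convergence concerns `a_N π_N`; dividing by `a_N`, eventually nonzero, gives that
  -- of `π_N`.
  have hweak : Tendsto π atTop (𝓝 (⟨M, inferInstance⟩ : ProbabilityMeasure Y)) := by
    refine ProbabilityMeasure.tendsto_iff_forall_integral_tendsto.2 fun f => ?_
    have h1 := (har.inv₀ one_ne_zero).mul (hζ f f.continuous (f.integrable M))
    rw [inv_one, one_mul] at h1
    refine h1.congr' ?_
    filter_upwards [har.eventually_ne one_ne_zero] with N hN
    have h2 := mul_integral_eq_sum_of_smul_eq (𝕜 := ℝ) (hπ N) f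
    simp_rw [mul_comm (f _)]
    exact (inv_mul_eq_iff_eq_mul₀ hN).2 h2.symm
  set H : Configuration Y × Y → ℝ := fun q => |differenceGradient q.2 F q.1| ^ 2 with hH
  have hHm : Measurable H := (measurable_differenceGradient hFP.1).abs.pow_const 2
  have hHc : Continuous H := (continuous_differenceGradient hF.continuous).abs.pow 2
  have hH1 (q : Configuration Y × Y) : |H q| ≤ 1 := by
    rw [hH, abs_pow, abs_abs]
    exact pow_le_one₀ (abs_nonneg _) (hF.abs_add_pointMass_sub_le q.1 q.2)
  have hlim := har.mul (tendsto_integral_integral_poissonMixture hweak ha hHm hHc 1 hH1)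
  have hform : poissonDirichletForm M P F =
      1 * ∫ ω, ∫ x, H (ω, x) ∂M ∂poissonMixture 1 M := by
    rw [one_mul, ← hP.eq_poissonMixture, poissonDirichletForm]
  rw [hform]
  -- Integrating the added point against `a_N π_N` produces the weighted sum over `ζ_k`, and the
  -- mixture is the law of `U_N`.
  have hmain (N : ℕ) : ∑ k, p N k *
      ∫ m, |differenceGradient (ζ N k) F (toConfiguration (ζ N) m)| ^ 2
        ∂Measure.pi (fun k => poissonMeasure (p N k)) =
      a N * ∫ ω, ∫ x, H (ω, x) ∂(π N : Measure Y) ∂poissonMixture (a N) (π N : Measure Y) := by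
    have hi (k : Fin N) : Integrable (fun ω => H (ω, ζ N k))
        (poissonMixture (a N) (π N : Measure Y)) :=
      Integrable.of_bound (hHm.comp (measurable_id.prodMk measurable_const)).aestronglyMeasurable 1
        (.of_forall fun ω => hH1 _)
    rw [← integral_const_mul]
    have h2 (ω : Configuration Y) :
        (a N : ℝ) * ∫ x, H (ω, x) ∂(π N : Measure Y) = ∑ k, (p N k : ℝ) * H (ω, ζ N k) :=
      mul_integral_eq_sum_of_smul_eq (𝕜 := ℝ) (hπ N) fun x => H (ω, x)
    simp_rw [h2]
    rw [integral_finsetSum _ fun k _ => (hi k).const_mul _]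
    refine Finset.sum_congr rfl fun k _ => ?_
    rw [integral_const_mul, ← map_toConfiguration_eq_poissonMixture (hπ N),
      integral_map (f := fun ω => H (ω, ζ N k)) .of_discrete (hHm.comp (measurable_id.prodMk
        measurable_const)).aestronglyMeasurable]
  have herr : Tendsto (fun N => 4 * ∑ k, (p N k : ℝ) ^ 2) atTop (𝓝 0) := by
    simpa using (tendsto_sum_sq_of_isBigO hp hsum).const_mul 4
  have hdiff := squeeze_zero_norm
    (f := fun N => imageDirichletForm (fun k => poissonMeasure (p N k)) (toConfiguration (ζ N)) F -
      ∑ k, p N k * ∫ m, |differenceGradient (ζ N k) F (toConfiguration (ζ N) m)| ^ 2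
        ∂Measure.pi fun k => poissonMeasure (p N k))
    (fun N => (hF.abs_imageDirichletForm_sub_le (p N) (ζ N))) herr
  have := hdiff.add hlim
  rw [zero_add] at this
  refine this.congr fun N => ?_
  rw [← hmain N, sub_add_cancel]
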